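/- **Theorem 1.** Let $n\ge 2$. There is no LOCC-implementable $n$-to-1 two-qubit entanglement purification protocol that is universal for the set of all two-qubit entangled states. Here an *$n$-to-1 entanglement purification protocol* is a two-branch quantum instrument $\mathcal E=\{\mathcal E_0,\mathcal E_1\}$: completely positive maps from the operators on $\bigotimes_{i=1}^n(\mathcal H_{A_i}\otimes\mathcal H_{B_i})$ to the operators on $\mathcal H_{\hat A}\otimes\mathcal H_{\hat B}$, all local spaces being $\mathbb C^2$, such that $\mathcal E_0+\mathcal E_1$ is trace preserving; $\mathcal E_0$ is the success branch, and it is assumed that $\mathcal E_0\neq 0$. Alice holds $A_1,\dots,A_n,\hat A$ and Bob holds $B_1,\dots,B_n,\hat B$. The fidelity of a two-qubit state $\rho$ is $F(\rho)=\langle\phi_2|\rho|\phi_2\rangle$ with $|\phi_2\rangle=(|00\rangle+|11\rangle)/\sqrt2$. The protocol is *universal* for a set $\mathcal S$ of two-qubit states if for all $\rho_1,\dots,\rho_n\in\mathcal S$ such that $\rho=\bigotimes_{i=1}^n\rho_i$ satisfies $\mathrm{tr}\,\mathcal E_0(\rho)\neq0$, $$F\!\left(\frac{\mathcal E_0(\rho)}{\mathrm{tr}\,\mathcal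 E_0(\rho)}\right)\ \ge\ \max\{F(\rho_1),\dots,F(\rho_n)\}.$$ A two-qubit state is *entangled* if it is not a convex combination of product states. The protocol is *LOCC-implementable* if the instrument is a limit of instruments each of which is implemented by finitely many rounds of local generalized measurements of Alice or of Bob (with finitely many outcomes, output spaces of arbitrary finite dimension, and a choice that may depend on all previous outcomes, which are communicated classically), followed by forgetting all outcomes except success or failure. This includes every protocol with finitely many rounds. -/

import Mathlib

open scoped Kronecker Matrix ComplexOrder
open Filter Topology

namespace Purification

/-- Operators on the Hilbert space with orthonormal basis `ι`. -/
abbrev Op (ι : Type) : Type := Matrix ι ι ℂ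

/-- Computational basis labels of one qubit. -/
abbrev Qubit : Type := Fin 2

/-- Basis labels of `n` qubits. -/
abbrev Qubits (n : ℕ) : Type := Fin n → Qubit

/-- A quantum state: a positive semidefinite operator of trace one. -/
def IsState {ι : Type} [Fintype ι] (ρ : Op ι) : Prop :=
  ρ.PosSemidef ∧ ρ.trace = 1

/-- The separable two-qubit states: convex combinations of products of one-qubit states. -/
def separableStates : Set (Op (Qubit × Qubit)) :=
  convexHull ℝ {ρ | ∃ σ τ : Op Qubit, IsState σ ∧ IsState τ ∧ ρ = σ ⊗ₖ τ}

/-- The entangled two-qubit states: the states that are not separable. -/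
def entangledStates : Set (Op (Qubit × Qubit)) :=
  {ρ | IsState ρ ∧ ρ ∉ separableStates}

/-- The Bell vector `(|00⟩ + |11⟩) / √2`. -/
noncomputable def bellVec : Qubit × Qubit → ℂ :=
  fun x => if x.1 = x.2 then ((1 / √2 : ℝ) : ℂ) else 0

/-- The fidelity `⟨φ|ρ|φ⟩` of a two-qubit operator with the Bell state. -/
noncomputable def fidelity (ρ : Op (Qubit × Qubit)) : ℝ :=
  (star bellVec ⬝ᵥ (ρ *ᵥ bellVec)).re

/-- The tensor product `ρ₁ ⊗ ⋯ ⊗ ρₙ` of `n` two-qubit operators, arranged so that Alice holds the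
first qubit and Bob the second qubit of every pair. -/
def tensorPairs {n : ℕ} (ρ : Fin n → Op (Qubit × Qubit)) : Op (Qubits n × Qubits n) :=
  Matrix.of fun x y => ∏ i, ρ i (x.1 i, x.2 i) (y.1 i, y.2 i)

section CP
open scoped Matrix.Norms.L2Operator MatrixOrder CStarAlgebra

/-- An `n`-to-1 two-qubit entanglement purification protocol, as a two-branch quantum instrument:
two completely positive maps, for success and for failure, whose sum preserves the trace. -/
structure EPP (n : ℕ) where
  success : Op (Qubits n × Qubits n) →CP Op (Qubit × Qubit)
  failure : Op (Qubits n × Qubits n) →CP Op (Qubit × Qubit)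
  trace_preserving : ∀ X, (success X + failure X).trace = X.trace

/-- The two branches of a protocol as linear maps; `true` stands for success. -/
def EPP.branch {n : ℕ} (E : EPP n) :
    Bool → Op (Qubits n × Qubits n) →ₗ[ℂ] Op (Qubit × Qubit)
  | true => E.success.toLinearMap
  | false => E.failure.toLinearMap

end CP

/-- The state `E₀(ρ) / tr E₀(ρ)` that a protocol outputs upon success. -/
noncomputable def EPP.output {n : ℕ} (E : EPP n) (ρ : Op (Qubits n × Qubits n)) :
    Op (Qubit × Qubit) :=
  (E.branch true ρ).trace⁻¹ • E.branch true ρ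

/-- A protocol is universal for a set `S` of two-qubit states if for all inputs from `S` the output
conditioned on success, whenever success has nonzero probability, has a fidelity that is at least
the fidelity of every input. -/
def EPP.IsUniversalFor {n : ℕ} (E : EPP n) (S : Set (Op (Qubit × Qubit))) : Prop :=
  ∀ ρ : Fin n → Op (Qubit × Qubit), (∀ i, ρ i ∈ S) →
    (E.branch true (tensorPairs ρ)).trace ≠ 0 →
      ∀ i, fidelity (ρ i) ≤ fidelity (E.output (tensorPairs ρ))

/-- The map `X ↦ K X K†`. -/
def conjBy {ι κ : Type} [Fintype ι] (K : Matrix κ ι ℂ) : Op ι →ₗ[ℂ] Op κ where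
  toFun X := K * X * Kᴴ
  map_add' X Y := by rw [Matrix.mul_add, Matrix.add_mul]
  map_smul' c X := by simp

/-- The instruments with outcomes in `Bool`, from a system shared by Alice (with basis `a`) and Bob
(with basis `b`) to one qubit for each of them, that are implemented by local operations and
finitely many rounds of classical communication.
In `alice`, Alice performs the generalized measurement with Kraus operators `K j`, whose output
spaces may be of any finite dimension (local ancillas may be added and discarded), and
announces the result `j`; Alice and Bob then continue with a protocol that may depend on `j`.
`bob` is the same with the parties interchanged. In `finish`, the parties stop and declare the
outcome `s`. Summing over `j` forgets everything but the declared outcome. -/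
inductive IsFiniteLOCC : ∀ (a b : Type) [Fintype a] [DecidableEq a] [Fintype b] [DecidableEq b],
    (Bool → Op (a × b) →ₗ[ℂ] Op (Qubit × Qubit)) → Prop
  | finish (s : Bool) :
      IsFiniteLOCC Qubit Qubit (fun t => if t = s then LinearMap.id else 0)
  | alice {a b : Type} [Fintype a] [DecidableEq a] [Fintype b] [DecidableEq b]
      {m : ℕ} (d : Fin m → ℕ) (K : ∀ j, Matrix (Fin (d j)) a ℂ)
      (hK : ∑ j, (K j)ᴴ * K j = 1)
      (J : ∀ j, Bool → Op (Fin (d j) × b) →ₗ[ℂ] Op (Qubit × Qubit))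
      (hJ : ∀ j, IsFiniteLOCC (Fin (d j)) b (J j)) :
      IsFiniteLOCC a b
        (fun t => ∑ j, J j t ∘ₗ conjBy (K j ⊗ₖ (1 : Matrix b b ℂ)))
  | bob {a b : Type} [Fintype a] [DecidableEq a] [Fintype b] [DecidableEq b]
      {m : ℕ} (d : Fin m → ℕ) (K : ∀ j, Matrix (Fin (d j)) b ℂ)
      (hK : ∑ j, (K j)ᴴ * K j = 1)
      (J : ∀ j, Bool → Op (a × Fin (d j)) →ₗ[ℂ] Op (Qubit × Qubit))
      (hJ : ∀ j, IsFiniteLOCC a (Fin (d j)) (J j)) :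
      IsFiniteLOCC a b
        (fun t => ∑ j, J j t ∘ₗ conjBy ((1 : Matrix a a ℂ) ⊗ₖ K j))

/-- A protocol is implementable by LOCC if it is a limit of instruments that are implemented by
finitely many rounds of LOCC. This covers protocols with finitely many rounds (constant
sequences), with unboundedly or infinitely many rounds, and the topological closure of LOCC. -/
def EPP.IsLOCC {n : ℕ} (E : EPP n) : Prop :=
  ∃ J : ℕ → Bool → Op (Qubits n × Qubits n) →ₗ[ℂ] Op (Qubit × Qubit),
    (∀ k, IsFiniteLOCC (Qubits n) (Qubits n) (J k)) ∧
      ∀ s X, Tendsto (fun k => J k s X) atTop (𝓝 (E.branch s X))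

end Purification

/-!
Write `t(ρ)` for the success probability `tr E₀(ρ₁ ⊗ ⋯ ⊗ ρₙ)` and `w(ρ)` for the unnormalized loss
of fidelity `tr E₀(ρ) - ⟨φ|E₀(ρ)|φ⟩`. Both are multilinear in the `ρᵢ` and satisfy `0 ≤ w ≤ t` on
states.

* LOCC enters only through product inputs: these are mapped to operators with positive partial
  transpose, a property that survives limits, so their output fidelity is at most `1/2`. Hence
  `t ≤ 2w` on product inputs (`EPP.IsLOCC.successProb_le`).
* Universality says `w(ρ) ≤ (1 - F(ρᵢ)) t(ρ)` for entangled inputs, hence for inputs in the closure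
  of the entangled states, which contains the Bell states and the product states used below. For
  `ρᵢ = (1 - ε)Φ + εσ`, which is entangled for every state `σ` once `ε < 1/2`, both sides are of
  order `ε`, and the limit `ε → 0` gives
  `w(…, σ, …) ≤ (1 - F(σ)) t(…, Φ, …)` (`EPP.successLoss_update_le`).

Fix all inputs but two as product basis states. What remains is linear arithmetic for a pair of
bilinear forms `t`, `w` (`IsUniversalPair`), using that sums of two Bell projectors are sums of two
product states: `|00⟩, |11⟩` add up to `Φ⁺ + Φ⁻`, `|++⟩, |--⟩` to `Φ⁺ + Ψ⁺`, and `|01⟩, |10⟩` to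
`Ψ⁺ + Ψ⁻`. The first two splittings, with fidelities `1/2`, give `t(Φ⁻, Φ⁺) = 0` and
`t(Φ⁻, Ψ⁺) = t(Φ⁺, Φ⁺)`. The third one, with fidelities `0`, then gives `t(Φ⁻, Ψ⁺) = 0`. So
`t(Φ⁺, Φ⁺) = 0`, and from there `t` vanishes on all pairs of product basis states. Summing over the
basis, `tr E₀(1) = 0`, and positivity of `E₀` forces `E₀ = 0`.
-/

namespace Purification

/-! ### Partial transposition and entanglement witnesses -/

/-- Partial transposition on the second tensor factor. -/
def partialTranspose (a b : Type) : Op (a × b) →ₗ[ℂ] Op (a × b) where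
  toFun ρ := Matrix.of fun x y => ρ (x.1, y.2) (y.1, x.2)
  map_add' _ _ := rfl
  map_smul' _ _ := rfl

theorem partialTranspose_apply {a b : Type} (ρ : Op (a × b)) (x y : a × b) :
    partialTranspose a b ρ x y = ρ (x.1, y.2) (y.1, x.2) := rfl

theorem partialTranspose_kronecker {a b : Type} (σ : Op a) (τ : Op b) :
    partialTranspose a b (σ ⊗ₖ τ) = σ ⊗ₖ τᵀ := rfl

theorem posSemidef_partialTranspose_kronecker {a b : Type} [Fintype a] [Fintype b]
    {σ : Op a} {τ : Op b} (hσ : σ.PosSemidef) (hτ : τ.PosSemidef) :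
    (partialTranspose a b (σ ⊗ₖ τ)).PosSemidef := by
  rw [partialTranspose_kronecker]
  exact hσ.kronecker hτ.transpose

/-- The entanglement witness `ρ ↦ ⟨v|ρ^Γ|v⟩`, where `Γ` is the partial transpose and the vector `v`
has coefficient matrix `V`. -/
noncomputable def ptWitness (V : Op Qubit) : Op (Qubit × Qubit) →ₗ[ℝ] ℝ where
  toFun ρ := (star (fun x : Qubit × Qubit => V x.1 x.2) ⬝ᵥ
    (partialTranspose Qubit Qubit ρ *ᵥ fun x => V x.1 x.2)).re
  map_add' ρ σ := by simp [Matrix.add_mulVec]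
  map_smul' c ρ := by
    rw [← Complex.coe_smul c ρ, map_smul, Matrix.smul_mulVec, dotProduct_smul, smul_eq_mul,
      Complex.re_ofReal_mul]
    rfl

theorem ptWitness_nonneg {V : Op Qubit} {ρ : Op (Qubit × Qubit)}
    (h : (partialTranspose Qubit Qubit ρ).PosSemidef) : 0 ≤ ptWitness V ρ :=
  (Complex.le_def.1 (h.dotProduct_mulVec_nonneg _)).1

theorem ptWitness_nonneg_of_separable {V : Op Qubit} {ρ : Op (Qubit × Qubit)}
    (h : ρ ∈ separableStates) : 0 ≤ ptWitness V ρ := by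
  have hconv : Convex ℝ {ρ | 0 ≤ ptWitness V ρ} :=
    convex_halfSpace_ge (ptWitness V).isLinear 0
  refine convexHull_min ?_ hconv h
  rintro _ ⟨σ, τ, hσ, hτ, rfl⟩
  exact ptWitness_nonneg (posSemidef_partialTranspose_kronecker hσ.1 hτ.1)

theorem mem_entangledStates {V : Op Qubit} {ρ : Op (Qubit × Qubit)} (hρ : IsState ρ)
    (h : ptWitness V ρ < 0) : ρ ∈ entangledStates :=
  ⟨hρ, fun hs => not_lt.2 (ptWitness_nonneg_of_separable hs) h⟩

theorem ptWitness_apply (V : Op Qubit) (ρ : Op (Qubit × Qubit)) :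
    ptWitness V ρ = (star (fun x : Qubit × Qubit => V x.1 x.2) ⬝ᵥ
    (partialTranspose Qubit Qubit ρ *ᵥ fun x => V x.1 x.2)).re := rfl

theorem IsState.convexComb {ι : Type} [Fintype ι] {ρ σ : Op ι} (hρ : IsState ρ) (hσ : IsState σ)
    {ε : ℝ} (h0 : 0 ≤ ε) (h1 : ε ≤ 1) : IsState ((1 - ε) • ρ + ε • σ) := by
  constructor
  · exact (hρ.1.smul (sub_nonneg.2 h1)).add (hσ.1.smul h0)
  · rw [Matrix.trace_add, Matrix.trace_smul, Matrix.trace_smul, hρ.2, hσ.2, ← add_smul]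
    simp

/-- A state on the boundary of a witness half-space is a limit of entangled states: mix it with a
state `β` that the witness detects. -/
theorem mem_closure_entangledStates {V : Op Qubit} {ρ β : Op (Qubit × Qubit)} (hρ : IsState ρ)
    (hβ : IsState β) (hVρ : ptWitness V ρ ≤ 0) (hVβ : ptWitness V β < 0) :
    ρ ∈ closure entangledStates := by
  have hlim : Tendsto (fun ε : ℝ => (1 - ε) • ρ + ε • β) (𝓝[>] 0) (𝓝 ρ) := by
    have : Continuous fun ε : ℝ => (1 - ε) • ρ + ε • β := by fun_prop
    simpa using (this.tendsto 0).mono_left nhdsWithin_le_nhds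
  refine mem_closure_of_tendsto hlim ?_
  filter_upwards [Ioo_mem_nhdsGT (zero_lt_one' ℝ)] with ε hε
  refine mem_entangledStates (V := V) (hρ.convexComb hβ hε.1.le hε.2.le) ?_
  rw [map_add, map_smul, map_smul, smul_eq_mul, smul_eq_mul]
  nlinarith [hε.1, hε.2]

/-! ### Bell states and product states -/

/-- The projector onto the vector with coefficient matrix `U / √2`. The four Bell projectors are
those for `U = 1` (`Φ⁺`), `Z` (`Φ⁻`), `X` (`Ψ⁺`) and `XZ` up to sign (`Ψ⁻`). -/
noncomputable def bellOp (U : Op Qubit) : Op (Qubit × Qubit) :=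
  (1 / 2 : ℝ) • Matrix.vecMulVec (fun x => U x.1 x.2) (star fun x => U x.1 x.2)

theorem bellOp_apply (U : Op Qubit) (x y : Qubit × Qubit) :
    bellOp U x y = 1 / 2 * (U x.1 x.2 * star (U y.1 y.2)) := by
  simp [bellOp, Matrix.vecMulVec_apply]

theorem isState_bellOp {U : Op Qubit} (hU : ∑ i, ∑ j, U i j * star (U i j) = 2) :
    IsState (bellOp U) := by
  constructor
  · exact (Matrix.posSemidef_vecMulVec_self_star _).smul (by norm_num)
  · simp only [Matrix.trace, Matrix.diag_apply, bellOp_apply, ← Finset.mul_sum,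
      Fintype.sum_prod_type, hU]
    norm_num

/-- The state `|k⟩⟨k|` of one qubit. -/
noncomputable def basisState (k : Qubit) : Op Qubit := Matrix.single k k 1

/-- The states `|+⟩⟨+|` (for `k = 0`) and `|-⟩⟨-|` (for `k = 1`) of one qubit. -/
noncomputable def hadamardState (k : Qubit) : Op Qubit :=
  (1 / 2 : ℝ) • Matrix.vecMulVec ![1, (-1) ^ (k : ℕ)] (star ![1, (-1) ^ (k : ℕ)])

theorem hadamardState_apply (k i j : Qubit) : hadamardState k i j =
    1 / 2 * ((![1, (-1) ^ (k : ℕ)] : Qubit → ℂ) i * star ((![1, (-1) ^ (k : ℕ)] : Qubit → ℂ) j)) := by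
  rw [hadamardState, Matrix.smul_apply, Matrix.vecMulVec_apply, Pi.star_apply, Complex.real_smul]
  norm_num

theorem isState_basisState (k : Qubit) : IsState (basisState k) := by
  constructor
  · have := Matrix.posSemidef_conjTranspose_mul_self (Matrix.single k k (1 : ℂ))
    simpa [basisState] using this
  · simp [basisState]

theorem isState_hadamardState (k : Qubit) : IsState (hadamardState k) := by
  constructor
  · exact (Matrix.posSemidef_vecMulVec_self_star _).smul (by norm_num)
  · rw [hadamardState, Matrix.trace_smul, Matrix.trace_vecMulVec]
    fin_cases k <;> simp [dotProduct, Fin.sum_univ_two] <;> norm_num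

theorem IsState.kronecker {a b : Type} [Fintype a] [Fintype b] {σ : Op a} {τ : Op b}
    (hσ : IsState σ) (hτ : IsState τ) : IsState (σ ⊗ₖ τ) :=
  ⟨hσ.1.kronecker hτ.1, by rw [Matrix.trace_kronecker, hσ.2, hτ.2, one_mul]⟩

/-- The Pauli matrix `X`. -/
abbrev pauliX : Op Qubit := !![0, 1; 1, 0]
/-- The Pauli matrix `Z`. -/
abbrev pauliZ : Op Qubit := !![1, 0; 0, -1]
/-- The matrix `!![0, 1; -1, 0]`, which is `X * Z` up to sign. -/
abbrev pauliXZ : Op Qubit := !![0, 1; -1, 0]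

theorem basisState_add_same :
    basisState 0 ⊗ₖ basisState 0 + basisState 1 ⊗ₖ basisState 1 = bellOp 1 + bellOp pauliZ := by
  ext ⟨i, j⟩ ⟨k, l⟩
  fin_cases i <;> fin_cases j <;> fin_cases k <;> fin_cases l <;>
    simp [basisState, bellOp_apply] <;> norm_num

theorem basisState_add_ne :
    basisState 0 ⊗ₖ basisState 1 + basisState 1 ⊗ₖ basisState 0 =
      bellOp pauliX + bellOp pauliXZ := by
  ext ⟨i, j⟩ ⟨k, l⟩
  fin_cases i <;> fin_cases j <;> fin_cases k <;> fin_cases l <;>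
    simp [basisState, bellOp_apply] <;> norm_num

theorem hadamardState_add_same :
    hadamardState 0 ⊗ₖ hadamardState 0 + hadamardState 1 ⊗ₖ hadamardState 1 =
      bellOp 1 + bellOp pauliX := by
  ext ⟨i, j⟩ ⟨k, l⟩
  fin_cases i <;> fin_cases j <;> fin_cases k <;> fin_cases l <;>
    simp [hadamardState_apply, bellOp_apply] <;> norm_num

theorem isState_bellOp_one : IsState (bellOp 1) := isState_bellOp (by simp [Fin.sum_univ_two]; norm_num)
theorem isState_bellOp_pauliX : IsState (bellOp pauliX) :=
  isState_bellOp (by simp [Fin.sum_univ_two]; norm_num)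
theorem isState_bellOp_pauliZ : IsState (bellOp pauliZ) :=
  isState_bellOp (by simp [Fin.sum_univ_two]; norm_num)
theorem isState_bellOp_pauliXZ : IsState (bellOp pauliXZ) :=
  isState_bellOp (by simp [Fin.sum_univ_two]; norm_num)

theorem fidelity_eq (ρ : Op (Qubit × Qubit)) : fidelity ρ =
    (1 / 2) * (ρ (0, 0) (0, 0) + ρ (0, 0) (1, 1) + ρ (1, 1) (0, 0) + ρ (1, 1) (1, 1)).re := by
  have h : (√2 : ℝ) ^ 2 = 2 := Real.sq_sqrt (by norm_num)
  simp [fidelity, bellVec, Fintype.sum_prod_type, dotProduct, Matrix.mulVec, Fin.sum_univ_two]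
  linear_combination ((ρ (0, 0) (0, 0)).re + (ρ (0, 0) (1, 1)).re + (ρ (1, 1) (0, 0)).re +
    (ρ (1, 1) (1, 1)).re) / 4 * h

/-- The singlet vector gives the witness `tr ρ - 2 F(ρ)`; in particular, separable states have
fidelity at most `1/2`. -/
theorem ptWitness_pauliXZ (ρ : Op (Qubit × Qubit)) :
    ptWitness pauliXZ ρ = ρ.trace.re - 2 * fidelity ρ := by
  rw [fidelity_eq]
  simp [ptWitness_apply, partialTranspose_apply, Fintype.sum_prod_type, dotProduct, Matrix.mulVec,
    Fin.sum_univ_two, Matrix.trace]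
  ring

theorem ptWitness_pauliX (ρ : Op (Qubit × Qubit)) :
    ptWitness pauliX ρ = (ρ (0, 1) (0, 1) + ρ (1, 0) (1, 0) + ρ (0, 0) (1, 1) +
      ρ (1, 1) (0, 0)).re := by
  simp [ptWitness_apply, partialTranspose_apply, Fintype.sum_prod_type, dotProduct, Matrix.mulVec,
    Fin.sum_univ_two]
  ring

theorem ptWitness_pauliZ (ρ : Op (Qubit × Qubit)) :
    ptWitness pauliZ ρ = (ρ (0, 0) (0, 0) + ρ (1, 1) (1, 1) - ρ (0, 1) (1, 0) -
      ρ (1, 0) (0, 1)).re := by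
  simp [ptWitness_apply, partialTranspose_apply, Fintype.sum_prod_type, dotProduct, Matrix.mulVec,
    Fin.sum_univ_two]
  ring

theorem fidelity_bellOp_one : fidelity (bellOp 1) = 1 := by
  rw [fidelity_eq]; simp [bellOp_apply]; norm_num

theorem fidelity_basisState_same (k : Qubit) :
    fidelity (basisState k ⊗ₖ basisState k) = 1 / 2 := by
  rw [fidelity_eq]; fin_cases k <;> simp [basisState]

theorem fidelity_basisState_ne {k l : Qubit} (h : k ≠ l) :
    fidelity (basisState k ⊗ₖ basisState l) = 0 := by
  rw [fidelity_eq]; revert h; fin_cases k <;> fin_cases l <;> simp [basisState]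

theorem fidelity_hadamardState_same (k : Qubit) :
    fidelity (hadamardState k ⊗ₖ hadamardState k) = 1 / 2 := by
  rw [fidelity_eq]; fin_cases k <;> simp [hadamardState_apply] <;> norm_num

theorem fidelity_nonneg {ρ : Op (Qubit × Qubit)} (hρ : ρ.PosSemidef) : 0 ≤ fidelity ρ :=
  (Complex.le_def.1 (hρ.dotProduct_mulVec_nonneg _)).1

/-- The difference of the two sides is the sum of the expectation values of `ρ` in `Φ⁻`, `|01⟩` and
`|10⟩`. -/
theorem fidelity_le_trace {ρ : Op (Qubit × Qubit)} (hρ : ρ.PosSemidef) :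
    fidelity ρ ≤ ρ.trace.re := by
  have h1 := (Complex.le_def.1 (hρ.dotProduct_mulVec_nonneg
    (fun x => pauliZ x.1 x.2))).1
  have h2 := (Complex.le_def.1 (hρ.diag_nonneg (i := (0, 1)))).1
  have h3 := (Complex.le_def.1 (hρ.diag_nonneg (i := (1, 0)))).1
  rw [fidelity_eq]
  simp [Fintype.sum_prod_type, dotProduct, Matrix.mulVec, Fin.sum_univ_two, Matrix.trace] at *
  linarith

theorem bellOp_one_mem : bellOp 1 ∈ closure entangledStates := by
  refine subset_closure (mem_entangledStates (V := pauliXZ) isState_bellOp_one ?_)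
  rw [ptWitness_pauliXZ, fidelity_bellOp_one, isState_bellOp_one.2]; norm_num

theorem bellOp_pauliZ_mem : bellOp pauliZ ∈ closure entangledStates := by
  refine subset_closure (mem_entangledStates (V := pauliX) isState_bellOp_pauliZ ?_)
  rw [ptWitness_pauliX]; simp [bellOp_apply]

theorem mem_closure_of_half_le_fidelity {ρ : Op (Qubit × Qubit)} (hρ : IsState ρ)
    (h : 1 / 2 ≤ fidelity ρ) : ρ ∈ closure entangledStates := by
  refine mem_closure_entangledStates (V := pauliXZ) hρ isState_bellOp_one ?_ ?_ <;>
    rw [ptWitness_pauliXZ]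
  · rw [hρ.2, Complex.one_re]; linarith
  · rw [fidelity_bellOp_one, isState_bellOp_one.2]; norm_num

theorem basisState_kronecker_mem (k l : Qubit) :
    basisState k ⊗ₖ basisState l ∈ closure entangledStates := by
  by_cases h : k = l
  · subst h
    exact mem_closure_of_half_le_fidelity ((isState_basisState k).kronecker (isState_basisState k))
      (fidelity_basisState_same k).ge
  · refine mem_closure_entangledStates (V := pauliZ)
      ((isState_basisState k).kronecker (isState_basisState l)) isState_bellOp_pauliX ?_ ?_ <;>
      rw [ptWitness_pauliZ]
    · revert h
      fin_cases k <;> fin_cases l <;> simp [basisState]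
    · simp [bellOp_apply]

/-- For `ε < 1/2` the fidelity of the mixture exceeds `1/2`, whatever `σ` is. -/
theorem add_smul_mem_entangledStates {σ : Op (Qubit × Qubit)} (hσ : IsState σ) {ε : ℝ}
    (h0 : 0 < ε) (h1 : ε < 1 / 2) : (1 - ε) • bellOp 1 + ε • σ ∈ entangledStates := by
  refine mem_entangledStates (V := pauliXZ) (isState_bellOp_one.convexComb hσ h0.le (by linarith)) ?_
  have := fidelity_nonneg hσ.1
  rw [map_add, map_smul, map_smul, ptWitness_pauliXZ, ptWitness_pauliXZ, fidelity_bellOp_one,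
    isState_bellOp_one.2, hσ.2]
  simp only [Complex.one_re, smul_eq_mul]
  nlinarith

/-! ### Tensor products of operators -/

/-- The tensor product of the operators `M i`. -/
def piTensor {n : ℕ} {ι : Type} (M : Fin n → Op ι) : Op (Fin n → ι) :=
  Matrix.of fun x y => ∏ i, M i (x i) (y i)

theorem piTensor_conjTranspose_mul {n : ℕ} {ι : Type} [Fintype ι] [DecidableEq ι] (M : Fin n → Op ι) :
    piTensor (fun i => (M i)ᴴ * M i) = (piTensor M)ᴴ * piTensor M := by
  ext x y
  simp only [piTensor, Matrix.of_apply, Matrix.mul_apply, Matrix.conjTranspose_apply, star_prod,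
    ← Finset.prod_mul_distrib]
  rw [Finset.prod_univ_sum, Fintype.piFinset_univ]

theorem posSemidef_piTensor {n : ℕ} {ι : Type} [Fintype ι] [DecidableEq ι] {M : Fin n → Op ι}
    (hM : ∀ i, (M i).PosSemidef) : (piTensor M).PosSemidef := by
  open scoped MatrixOrder Matrix.Norms.L2Operator in
  have h : ∀ i, ∃ B : Op ι, M i = Bᴴ * B := fun i =>
    CStarAlgebra.nonneg_iff_eq_star_mul_self.1 (Matrix.nonneg_iff_posSemidef.2 (hM i))
  choose B hB using h
  rw [funext hB, piTensor_conjTranspose_mul]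
  exact Matrix.posSemidef_conjTranspose_mul_self _

theorem tensorPairs_eq_submatrix {n : ℕ} (ρ : Fin n → Op (Qubit × Qubit)) :
    tensorPairs ρ = (piTensor ρ).submatrix (fun x i => (x.1 i, x.2 i)) fun x i => (x.1 i, x.2 i) :=
  rfl

theorem posSemidef_tensorPairs {n : ℕ} {ρ : Fin n → Op (Qubit × Qubit)} (hρ : ∀ i, (ρ i).PosSemidef) :
    (tensorPairs ρ).PosSemidef := by
  rw [tensorPairs_eq_submatrix]
  exact (posSemidef_piTensor hρ).submatrix _

theorem tensorPairs_kronecker {n : ℕ} (σ τ : Fin n → Op Qubit) :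
    tensorPairs (fun i => σ i ⊗ₖ τ i) = piTensor σ ⊗ₖ piTensor τ := by
  ext x y
  simp [tensorPairs, piTensor, Matrix.kroneckerMap_apply, Finset.prod_mul_distrib]

/-- `tensorPairs` as a multilinear map. -/
noncomputable def tensorPairsMultilinear (n : ℕ) :
    MultilinearMap ℂ (fun _ : Fin n => Op (Qubit × Qubit)) (Op (Qubits n × Qubits n)) where
  toFun := tensorPairs
  map_update_add' {inst} ρ i X Y := by
    ext x y
    exact ((MultilinearMap.mkPiAlgebra ℂ (Fin n) ℂ).compLinearMap fun i =>
      Matrix.entryLinearMap ℂ ℂ (x.1 i, x.2 i) (y.1 i, y.2 i)).map_update_add ρ i X Y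
  map_update_smul' {inst} ρ i c X := by
    ext x y
    exact ((MultilinearMap.mkPiAlgebra ℂ (Fin n) ℂ).compLinearMap fun i =>
      Matrix.entryLinearMap ℂ ℂ (x.1 i, x.2 i) (y.1 i, y.2 i)).map_update_smul ρ i c X

theorem sum_tensorPairs_basisState {n : ℕ} :
    ∑ x : Fin n → Qubit × Qubit,
      tensorPairs (fun i => basisState (x i).1 ⊗ₖ basisState (x i).2) = 1 := by
  have h1 : ∑ k : Qubit × Qubit, basisState k.1 ⊗ₖ basisState k.2 = 1 := by
    rw [Fintype.sum_prod_type, ← Matrix.one_kronecker_one]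
    ext ⟨i, j⟩ ⟨k, l⟩
    fin_cases i <;> fin_cases j <;> fin_cases k <;> fin_cases l <;>
      simp [basisState, Fin.sum_univ_two]
  have h := (tensorPairsMultilinear n).map_sum
    (fun (_ : Fin n) (k : Qubit × Qubit) => basisState k.1 ⊗ₖ basisState k.2)
  rw [h1] at h
  refine h.symm.trans ?_
  ext x y
  change ∏ i, (1 : Op (Qubit × Qubit)) (x.1 i, x.2 i) (y.1 i, y.2 i) = _
  by_cases hxy : x = y
  · subst hxy; simp
  · rw [Matrix.one_apply_ne hxy]
    have : ∃ i, (x.1 i, x.2 i) ≠ (y.1 i, y.2 i) := by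
      by_contra! hc
      exact hxy (Prod.ext (funext fun i => (Prod.ext_iff.1 (hc i)).1)
        (funext fun i => (Prod.ext_iff.1 (hc i)).2))
    obtain ⟨i, hi⟩ := this
    exact Finset.prod_eq_zero (Finset.mem_univ i) (Matrix.one_apply_ne hi)

theorem continuous_tensorPairs {n : ℕ} : Continuous (tensorPairs (n := n)) := by
  refine continuous_matrix fun x y => ?_
  simp only [tensorPairs, Matrix.of_apply]
  fun_prop

/-! ### LOCC maps on product inputs -/

/-- Each round acts on one factor of a product operator only, so every branch yields a sum of
products of positive operators. -/
theorem posSemidef_partialTranspose_of_isFiniteLOCC {a b : Type} [Fintype a] [DecidableEq a]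
    [Fintype b] [DecidableEq b] {J : Bool → Op (a × b) →ₗ[ℂ] Op (Qubit × Qubit)}
    (hJ : IsFiniteLOCC a b J) (s : Bool) {X : Op a} {Y : Op b} (hX : X.PosSemidef)
    (hY : Y.PosSemidef) : (partialTranspose Qubit Qubit (J s (X ⊗ₖ Y))).PosSemidef := by
  induction hJ with
  | finish t =>
    by_cases h : s = t
    · simpa [h] using posSemidef_partialTranspose_kronecker hX hY
    · simpa [h] using Matrix.PosSemidef.zero
  | alice d K hK J hJ ih =>
    simp only [LinearMap.sum_apply, map_sum, LinearMap.comp_apply]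
    refine Matrix.posSemidef_sum _ fun j _ => ?_
    have : conjBy (K j ⊗ₖ (1 : Matrix _ _ ℂ)) (X ⊗ₖ Y) = (K j * X * (K j)ᴴ) ⊗ₖ Y := by
      simp [conjBy, Matrix.conjTranspose_kronecker, ← Matrix.mul_kronecker_mul]
    rw [this]
    exact ih j (hX.mul_mul_conjTranspose_same _) hY
  | bob d K hK J hJ ih =>
    simp only [LinearMap.sum_apply, map_sum, LinearMap.comp_apply]
    refine Matrix.posSemidef_sum _ fun j _ => ?_
    have : conjBy ((1 : Matrix _ _ ℂ) ⊗ₖ K j) (X ⊗ₖ Y) = X ⊗ₖ (K j * Y * (K j)ᴴ) := by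
      simp [conjBy, Matrix.conjTranspose_kronecker, ← Matrix.mul_kronecker_mul]
    rw [this]
    exact ih j hX (hY.mul_mul_conjTranspose_same _)

/-- On product inputs the output fidelity of an LOCC protocol is at most `1/2`. -/
theorem EPP.IsLOCC.fidelity_le {n : ℕ} {E : EPP n} (hE : E.IsLOCC) (s : Bool) {X Y : Op (Qubits n)}
    (hX : X.PosSemidef) (hY : Y.PosSemidef) :
    2 * fidelity (E.branch s (X ⊗ₖ Y)) ≤ (E.branch s (X ⊗ₖ Y)).trace.re := by
  obtain ⟨J, hJ, hlim⟩ := hE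
  rw [← sub_nonneg, ← ptWitness_pauliXZ]
  have hcont : Continuous (ptWitness pauliXZ) := LinearMap.continuous_of_finiteDimensional _
  exact ge_of_tendsto' ((hcont.tendsto _).comp (hlim s (X ⊗ₖ Y))) fun k =>
    ptWitness_nonneg (posSemidef_partialTranspose_of_isFiniteLOCC (hJ k) s hX hY)

/-! ### Positivity of the success branch -/

section Positivity
open scoped Matrix.Norms.L2Operator MatrixOrder CStarAlgebra

theorem EPP.posSemidef_branch {n : ℕ} (E : EPP n) {X : Op (Qubits n × Qubits n)}
    (hX : X.PosSemidef) : (E.branch true X).PosSemidef := by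
  rw [← Matrix.nonneg_iff_posSemidef] at hX ⊢
  exact map_nonneg E.success hX

/-- A positive map that vanishes on `1` vanishes on every self-adjoint `X`, because
`-‖X‖ ≤ X ≤ ‖X‖`. -/
theorem EPP.branch_eq_zero {n : ℕ} (E : EPP n) (h : (E.branch true 1).trace = 0) :
    E.branch true = 0 := by
  have h1 : E.branch true 1 = 0 :=
    (E.posSemidef_branch Matrix.PosSemidef.one).trace_eq_zero_iff.1 h
  have hsa : ∀ X : Op (Qubits n × Qubits n), IsSelfAdjoint X → E.branch true X = 0 := by
    intro X hX
    have hc : ∀ r : ℝ, E.branch true (algebraMap ℝ _ r) = 0 := fun r => by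
      rw [Algebra.algebraMap_eq_smul_one, ← Complex.coe_smul, map_smul, h1, smul_zero]
    have hup := (OrderHomClass.mono E.success) hX.le_algebraMap_norm_self
    have hlo := (OrderHomClass.mono E.success) hX.neg_algebraMap_norm_le_self
    refine le_antisymm (hup.trans_eq (hc _)) (le_trans (le_of_eq ?_) hlo)
    exact (((E.branch true).map_neg _).trans (by rw [hc, neg_zero])).symm
  ext1 X
  rw [← realPart_add_I_smul_imaginaryPart X, map_add, map_smul, hsa _ (realPart X).2,
    hsa _ (imaginaryPart X).2]
  simp

end Positivity

/-! ### The bilinear inequalities on Bell states -/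

/-- The products of two one-qubit states. -/
def productStates : Set (Op (Qubit × Qubit)) :=
  {ρ | ∃ σ τ : Op Qubit, IsState σ ∧ IsState τ ∧ ρ = σ ⊗ₖ τ}

theorem isState_of_mem_productStates {ρ : Op (Qubit × Qubit)} (h : ρ ∈ productStates) :
    IsState ρ := by
  obtain ⟨σ, τ, hσ, hτ, rfl⟩ := h
  exact hσ.kronecker hτ

theorem basisState_kronecker_mem_productStates (k l : Qubit) :
    basisState k ⊗ₖ basisState l ∈ productStates :=
  ⟨_, _, isState_basisState k, isState_basisState l, rfl⟩

/-- What locality and universality imply for the success probability `t` and the unnormalized loss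
of fidelity `w` as functions of two inputs, the other inputs being fixed. -/
structure IsUniversalPair (t w : Op (Qubit × Qubit) →ₗ[ℝ] Op (Qubit × Qubit) →ₗ[ℝ] ℝ) : Prop where
  nonneg : ∀ ρ σ, ρ.PosSemidef → σ.PosSemidef → 0 ≤ w ρ σ
  le : ∀ ρ σ, ρ.PosSemidef → σ.PosSemidef → w ρ σ ≤ t ρ σ
  le_of_product : ∀ ρ ∈ productStates, ∀ σ ∈ productStates, t ρ σ ≤ 2 * w ρ σ
  left : ∀ ρ, IsState ρ → ∀ σ ∈ closure entangledStates,
    w ρ σ ≤ (1 - fidelity ρ) * t (bellOp 1) σ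
  right : ∀ ρ ∈ closure entangledStates, ∀ σ, IsState σ →
    w ρ σ ≤ (1 - fidelity σ) * t ρ (bellOp 1)

/-- The state `B` completes `Φ⁺` to a sum of two product states `p 0`, `p 1` of fidelity `1/2`. -/
structure IsBellSplitting (p : Qubit → Op (Qubit × Qubit)) (B : Op (Qubit × Qubit)) : Prop where
  mem : ∀ k, p k ∈ productStates
  fidelity_eq : ∀ k, fidelity (p k) = 1 / 2
  add : p 0 + p 1 = bellOp 1 + B
  isState : IsState B

theorem isBellSplitting_basisState :
    IsBellSplitting (fun k => basisState k ⊗ₖ basisState k) (bellOp pauliZ) where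
  mem k := basisState_kronecker_mem_productStates k k
  fidelity_eq := fidelity_basisState_same
  add := basisState_add_same
  isState := isState_bellOp_pauliZ

theorem isBellSplitting_hadamardState :
    IsBellSplitting (fun k => hadamardState k ⊗ₖ hadamardState k) (bellOp pauliX) where
  mem k := ⟨_, _, isState_hadamardState k, isState_hadamardState k, rfl⟩
  fidelity_eq := fidelity_hadamardState_same
  add := hadamardState_add_same
  isState := isState_bellOp_pauliX

namespace IsBellSplitting
variable {p : Qubit → Op (Qubit × Qubit)} {B : Op (Qubit × Qubit)}

theorem mem_closure (h : IsBellSplitting p B) (k : Qubit) : p k ∈ closure entangledStates :=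
  mem_closure_of_half_le_fidelity (isState_of_mem_productStates (h.mem k)) (h.fidelity_eq k).ge

theorem map_add {M : Type*} [AddCommMonoid M] [Module ℝ M] (h : IsBellSplitting p B)
    (f : Op (Qubit × Qubit) →ₗ[ℝ] M) : f (p 0) + f (p 1) = f (bellOp 1) + f B := by
  rw [← _root_.map_add, h.add, _root_.map_add]

end IsBellSplitting

namespace IsUniversalPair
variable {t w : Op (Qubit × Qubit) →ₗ[ℝ] Op (Qubit × Qubit) →ₗ[ℝ] ℝ}

theorem flip (h : IsUniversalPair t w) : IsUniversalPair t.flip w.flip where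
  nonneg ρ σ hρ hσ := h.nonneg σ ρ hσ hρ
  le ρ σ hρ hσ := h.le σ ρ hσ hρ
  le_of_product ρ hρ σ hσ := h.le_of_product σ hσ ρ hρ
  left ρ hρ σ hσ := h.right σ hσ ρ hρ
  right ρ hρ σ hσ := h.left σ hσ ρ hρ

theorem prob_nonneg (h : IsUniversalPair t w) {ρ σ : Op (Qubit × Qubit)} (hρ : ρ.PosSemidef)
    (hσ : σ.PosSemidef) : 0 ≤ t ρ σ :=
  (h.nonneg ρ σ hρ hσ).trans (h.le ρ σ hρ hσ)

theorem loss_bell_left (h : IsUniversalPair t w) {σ : Op (Qubit × Qubit)}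
    (hσ : σ ∈ closure entangledStates) : w (bellOp 1) σ ≤ 0 := by
  have := h.left _ isState_bellOp_one σ hσ
  rwa [fidelity_bellOp_one, sub_self, zero_mul] at this

/-- Both bounds come from summing inequalities over the four product inputs `(p k, c l)`: the first
from `t / 2 ≤ w ≤ t(Φ⁺, ·) / 2`, the second from `t / 2 ≤ w`, where the losses add up to `w B C`
because a Bell state `Φ⁺` as either input leaves no loss. -/
theorem bell_splitting_bounds (h : IsUniversalPair t w) {p c : Qubit → Op (Qubit × Qubit)}
    {B C : Op (Qubit × Qubit)} (hp : IsBellSplitting p B) (hc : IsBellSplitting c C) :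
    t B (bellOp 1) + t B C ≤ t (bellOp 1) (bellOp 1) + t (bellOp 1) C ∧
    t (bellOp 1) (bellOp 1) + t B (bellOp 1) + t (bellOp 1) C + t B C ≤ 2 * w B C := by
  have hprod k l := h.le_of_product _ (hp.mem k) _ (hc.mem l)
  have hleft k l : w (p k) (c l) ≤ 1 / 2 * t (bellOp 1) (c l) := by
    have := h.left _ (isState_of_mem_productStates (hp.mem k)) _ (hc.mem_closure l)
    rw [hp.fidelity_eq] at this
    linarith
  have ht1 := hc.map_add (t (bellOp 1))
  have ht2 := hc.map_add (t B)
  have hw1 := hc.map_add (w (bellOp 1))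
  have hw2 := hc.map_add (w B)
  have ht l := hp.map_add (t.flip (c l))
  have hw l := hp.map_add (w.flip (c l))
  have hwp := hp.map_add (w.flip (bellOp 1))
  simp only [LinearMap.flip_apply] at ht hw hwp
  have hz1 l := h.loss_bell_left (hc.mem_closure l)
  have hz2 k := h.flip.loss_bell_left (hp.mem_closure k)
  simp only [LinearMap.flip_apply] at hz2
  have hb := h.nonneg _ _ isState_bellOp_one.1 isState_bellOp_one.1
  have h00 := hprod 0 0
  have h01 := hprod 0 1
  have h10 := hprod 1 0
  have h11 := hprod 1 1
  have l00 := hleft 0 0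
  have l01 := hleft 0 1
  have l10 := hleft 1 0
  have l11 := hleft 1 1
  have := ht 0
  have := ht 1
  have := hw 0
  have := hw 1
  have := hz1 0
  have := hz1 1
  have := hz2 0
  have := hz2 1
  constructor <;> linarith

theorem bell_splitting_eq (h : IsUniversalPair t w) {p c : Qubit → Op (Qubit × Qubit)}
    {B C : Op (Qubit × Qubit)} (hp : IsBellSplitting p B) (hc : IsBellSplitting c C) :
    t B (bellOp 1) = 0 ∧ t (bellOp 1) C = 0 ∧ t B C = t (bellOp 1) (bellOp 1) := by
  obtain ⟨h1, h2⟩ := h.bell_splitting_bounds hp hc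
  obtain ⟨h3, -⟩ := h.flip.bell_splitting_bounds hc hp
  simp only [LinearMap.flip_apply] at h3
  have h4 := h.le _ _ hp.isState.1 hc.isState.1
  have h5 := h.prob_nonneg hp.isState.1 isState_bellOp_one.1
  have h6 := h.prob_nonneg isState_bellOp_one.1 hc.isState.1
  refine ⟨?_, ?_, ?_⟩ <;> linarith

/-- Here `|01⟩` and `|10⟩` have fidelity `0`, so universality for the second input bounds the loss
at `(Φ⁻, x)` by `t(Φ⁻, Φ⁺) = 0`. With the loss at `(Φ⁺, x)` zero as well, there is none at
`(|00⟩, x)` and `(|11⟩, x)`, which are product inputs. -/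
theorem prob_bell_basisState_ne (h : IsUniversalPair t w) {k l : Qubit} (hkl : k ≠ l) :
    t (bellOp 1) (basisState k ⊗ₖ basisState l) = 0 ∧
      t (bellOp pauliZ) (basisState k ⊗ₖ basisState l) = 0 := by
  set x := basisState k ⊗ₖ basisState l with hx
  have hxD : x ∈ closure entangledStates := basisState_kronecker_mem k l
  have hxp : x ∈ productStates := basisState_kronecker_mem_productStates k l
  have hxs := isState_of_mem_productStates hxp
  have hp := isBellSplitting_basisState
  have h0 := (h.bell_splitting_eq hp hp).1
  have h1 := h.right _ bellOp_pauliZ_mem x hxs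
  rw [hx, fidelity_basisState_ne hkl, ← hx, h0] at h1
  have h2 := h.loss_bell_left hxD
  have h3 := h.le_of_product _ (hp.mem 0) x hxp
  have h4 := h.le_of_product _ (hp.mem 1) x hxp
  have h5 := hp.map_add (t.flip x)
  have h6 := hp.map_add (w.flip x)
  simp only [LinearMap.flip_apply] at h5 h6
  have h7 := h.prob_nonneg isState_bellOp_one.1 hxs.1
  have h8 := h.prob_nonneg isState_bellOp_pauliZ.1 hxs.1
  constructor <;> linarith

/-- `t(Φ⁻, Ψ⁺)` equals `t(Φ⁺, Φ⁺)` by the splittings of `Φ⁺ + Φ⁻` and `Φ⁺ + Ψ⁺`, and is zero by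
the splitting of `Ψ⁺ + Ψ⁻` into `|01⟩` and `|10⟩`. -/
theorem prob_bell_bell (h : IsUniversalPair t w) : t (bellOp 1) (bellOp 1) = 0 := by
  have h1 := (h.bell_splitting_eq isBellSplitting_basisState isBellSplitting_hadamardState).2.2
  have h2 := (h.prob_bell_basisState_ne (zero_ne_one (α := Fin 2))).2
  have h3 := (h.prob_bell_basisState_ne (one_ne_zero (α := Fin 2))).2
  have h4 := congrArg (t (bellOp pauliZ)) basisState_add_ne
  rw [map_add, map_add, h2, h3] at h4
  have h5 := h.prob_nonneg isState_bellOp_pauliZ.1 isState_bellOp_pauliX.1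
  have h6 := h.prob_nonneg isState_bellOp_pauliZ.1 isState_bellOp_pauliXZ.1
  linarith

theorem prob_bell_basisState (h : IsUniversalPair t w) (k l : Qubit) :
    t (bellOp 1) (basisState k ⊗ₖ basisState l) = 0 := by
  by_cases hkl : k = l
  · subst hkl
    have hp := isBellSplitting_basisState
    have h1 := hp.map_add (t (bellOp 1))
    rw [h.prob_bell_bell, (h.bell_splitting_eq hp hp).2.1] at h1
    have h2 m := h.prob_nonneg isState_bellOp_one.1 (isState_of_mem_productStates (hp.mem m)).1
    have h3 := h2 0
    have h4 := h2 1
    fin_cases k <;> simp only [Fin.zero_eta, Fin.mk_one] <;> linarith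
  · exact (h.prob_bell_basisState_ne hkl).1

theorem prob_basisState (h : IsUniversalPair t w) (k l k' l' : Qubit) :
    t (basisState k ⊗ₖ basisState l) (basisState k' ⊗ₖ basisState l') = 0 := by
  have hm := basisState_kronecker_mem_productStates
  have h1 := h.left _ (isState_of_mem_productStates (hm k l)) _ (basisState_kronecker_mem k' l')
  rw [h.prob_bell_basisState, mul_zero] at h1
  have h2 := h.le_of_product _ (hm k l) _ (hm k' l')
  have h3 := h.prob_nonneg (isState_of_mem_productStates (hm k l)).1
    (isState_of_mem_productStates (hm k' l')).1
  linarith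

end IsUniversalPair

/-! ### Success probability and fidelity loss of a protocol -/

/-- The real part of the trace as a real linear functional. -/
noncomputable def traceRe : Op (Qubit × Qubit) →ₗ[ℝ] ℝ where
  toFun ρ := ρ.trace.re
  map_add' ρ σ := by simp
  map_smul' c ρ := by simp [Matrix.trace_smul]

/-- The weight `tr ρ - F(ρ)` of an operator outside the Bell state, as a real linear functional. -/
noncomputable def fidelityLoss : Op (Qubit × Qubit) →ₗ[ℝ] ℝ where
  toFun ρ := ρ.trace.re - fidelity ρ
  map_add' ρ σ := by simp [fidelity_eq]; ring
  map_smul' c ρ := by simp [fidelity_eq, Matrix.trace_smul]; ring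

namespace EPP
variable {n : ℕ}

/-- A functional of the unnormalized output upon success, as a function of the `n` input pairs. -/
noncomputable def onPairs (E : EPP n) (ℓ : Op (Qubit × Qubit) →ₗ[ℝ] ℝ) :
    MultilinearMap ℝ (fun _ : Fin n => Op (Qubit × Qubit)) ℝ :=
  (ℓ ∘ₗ (E.branch true).restrictScalars ℝ).compMultilinearMap
    ((tensorPairsMultilinear n).restrictScalars ℝ)

/-- The probability of success. -/
noncomputable abbrev successProb (E : EPP n) := E.onPairs traceRe

/-- The loss of fidelity upon success, weighted by the probability of success. -/
noncomputable abbrev successLoss (E : EPP n) := E.onPairs fidelityLoss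

theorem successProb_apply (E : EPP n) (ρ : Fin n → Op (Qubit × Qubit)) :
    E.successProb ρ = (E.branch true (tensorPairs ρ)).trace.re := rfl

theorem successLoss_apply (E : EPP n) (ρ : Fin n → Op (Qubit × Qubit)) :
    E.successLoss ρ = (E.branch true (tensorPairs ρ)).trace.re -
      fidelity (E.branch true (tensorPairs ρ)) := rfl

theorem continuous_onPairs (E : EPP n) (ℓ : Op (Qubit × Qubit) →ₗ[ℝ] ℝ) :
    Continuous (E.onPairs ℓ) :=
  (LinearMap.continuous_of_finiteDimensional
    (ℓ ∘ₗ (E.branch true).restrictScalars ℝ)).comp continuous_tensorPairs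

theorem successLoss_le_of_entangled {E : EPP n} (hE : E.IsUniversalFor entangledStates)
    {ρ : Fin n → Op (Qubit × Qubit)} (hρ : ∀ i, ρ i ∈ entangledStates) (i : Fin n) :
    E.successLoss ρ ≤ (1 - fidelity (ρ i)) * E.successProb ρ := by
  have hpos := E.posSemidef_branch (posSemidef_tensorPairs fun i => (hρ i).1.1)
  have h := hE ρ hρ
  rw [successLoss_apply, successProb_apply]
  simp only [output] at h
  set X := E.branch true (tensorPairs ρ)
  have htr : X.trace = ((X.trace.re : ℝ) : ℂ) := Complex.eq_re_of_ofReal_le hpos.trace_nonneg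
  have hnn : 0 ≤ X.trace.re := (Complex.le_def.1 hpos.trace_nonneg).1
  by_cases h0 : X.trace = 0
  · have := fidelity_nonneg hpos
    rw [h0]; simpa
  · have h1 := h h0 i
    have hne : X.trace.re ≠ 0 := fun hz => h0 (by rw [htr, hz]; rfl)
    have h2 : fidelity (X.trace⁻¹ • X) = X.trace.re⁻¹ * fidelity X := by
      rw [htr, ← Complex.ofReal_inv]
      simp [fidelity, Matrix.smul_mulVec]
    rw [h2, ← div_eq_inv_mul, le_div_iff₀ (lt_of_le_of_ne hnn hne.symm)] at h1
    linarith

theorem continuous_fidelity : Continuous fidelity := by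
  have : fidelity = fun ρ => (1 / 2) *
    (ρ (0, 0) (0, 0) + ρ (0, 0) (1, 1) + ρ (1, 1) (0, 0) + ρ (1, 1) (1, 1)).re :=
    funext fidelity_eq
  rw [this]
  fun_prop

theorem successLoss_le {E : EPP n} (hE : E.IsUniversalFor entangledStates)
    {ρ : Fin n → Op (Qubit × Qubit)} (hρ : ∀ i, ρ i ∈ closure entangledStates) (i : Fin n) :
    E.successLoss ρ ≤ (1 - fidelity (ρ i)) * E.successProb ρ := by
  have hclosed : IsClosed {ρ : Fin n → Op (Qubit × Qubit) |
      E.successLoss ρ ≤ (1 - fidelity (ρ i)) * E.successProb ρ} :=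
    isClosed_le (E.continuous_onPairs _)
      ((continuous_const.sub (continuous_fidelity.comp (continuous_apply i))).mul
        (E.continuous_onPairs _))
  have hsub : closure (Set.univ.pi fun _ : Fin n => entangledStates) ⊆ _ :=
    closure_minimal
      (fun ρ hρ => successLoss_le_of_entangled hE (fun j => hρ j trivial) i) hclosed
  refine hsub ?_
  rw [closure_pi_set]
  exact fun j _ => hρ j

theorem posSemidef_of_mem_closure {ρ : Op (Qubit × Qubit)} (hρ : ρ ∈ closure entangledStates) :
    ρ.PosSemidef := by
  have hcl : IsClosed {ρ : Op (Qubit × Qubit) | ρ.PosSemidef} := by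
    simp only [Matrix.posSemidef_iff_dotProduct_mulVec, Set.ofPred_and, Set.ofPred_forall]
    refine (isClosed_eq (by fun_prop) continuous_id).inter (isClosed_iInter fun x => ?_)
    exact isClosed_le continuous_const (by fun_prop)
  exact closure_minimal (fun ρ hρ => hρ.1.1) hcl hρ

theorem successLoss_nonneg (E : EPP n) {ρ : Fin n → Op (Qubit × Qubit)}
    (hρ : ∀ i, (ρ i).PosSemidef) : 0 ≤ E.successLoss ρ :=
  sub_nonneg.2 (fidelity_le_trace (E.posSemidef_branch (posSemidef_tensorPairs hρ)))

theorem successLoss_le_successProb (E : EPP n) {ρ : Fin n → Op (Qubit × Qubit)}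
    (hρ : ∀ i, (ρ i).PosSemidef) : E.successLoss ρ ≤ E.successProb ρ :=
  sub_le_self _ (fidelity_nonneg (E.posSemidef_branch (posSemidef_tensorPairs hρ)))

theorem IsLOCC.successProb_le {E : EPP n} (hE : E.IsLOCC) {ρ : Fin n → Op (Qubit × Qubit)}
    (hρ : ∀ i, ρ i ∈ productStates) : E.successProb ρ ≤ 2 * E.successLoss ρ := by
  choose σ τ hσ hτ h using hρ
  obtain rfl : ρ = fun i => σ i ⊗ₖ τ i := funext h
  have := hE.fidelity_le true (posSemidef_piTensor fun i => (hσ i).1)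
    (posSemidef_piTensor fun i => (hτ i).1)
  rw [← tensorPairs_kronecker] at this
  rw [successLoss_apply, successProb_apply]
  linarith

/-- Universality to first order at `Φ⁺`: the inequality for the input `(1 - ε)Φ⁺ + εσ` has both sides
of order `ε`. -/
theorem successLoss_update_le {E : EPP n} (hE : E.IsUniversalFor entangledStates)
    {ρ : Fin n → Op (Qubit × Qubit)} {i : Fin n}
    (hρ : ∀ j, j ≠ i → ρ j ∈ closure entangledStates) {σ : Op (Qubit × Qubit)} (hσ : IsState σ) :
    E.successLoss (Function.update ρ i σ) ≤
      (1 - fidelity σ) * E.successProb (Function.update ρ i (bellOp 1)) := by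
  set Φ : Op (Qubit × Qubit) := bellOp 1
  have hmem {β : Op (Qubit × Qubit)} (hβ : β ∈ closure entangledStates) (j : Fin n) :
      Function.update ρ i β j ∈ closure entangledStates := by
    by_cases hj : j = i
    · subst hj; simpa using hβ
    · simpa [hj] using hρ j hj
  have h0 : 0 ≤ E.successLoss (Function.update ρ i Φ) :=
    E.successLoss_nonneg fun j => posSemidef_of_mem_closure (hmem bellOp_one_mem j)
  -- the inequality for `(1 - ε) Φ + ε σ`, divided by `ε`
  have hev : ∀ᶠ ε : ℝ in 𝓝[>] 0, E.successLoss (Function.update ρ i σ) ≤ (1 - fidelity σ) *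
      ((1 - ε) * E.successProb (Function.update ρ i Φ) +
        ε * E.successProb (Function.update ρ i σ)) := by
    filter_upwards [Ioo_mem_nhdsGT (show (0 : ℝ) < 1 / 2 by norm_num)] with ε hε
    have h := successLoss_le hE
      (hmem (subset_closure (add_smul_mem_entangledStates hσ hε.1 hε.2))) i
    have hF : fidelity ((1 - ε) • Φ + ε • σ) = (1 - ε) + ε * fidelity σ := by
      have h1 := fidelityLoss.map_add ((1 - ε) • Φ) (ε • σ)
      rw [map_smul, map_smul] at h1
      simp only [fidelityLoss, LinearMap.coe_mk, AddHom.coe_mk, smul_eq_mul, Matrix.trace_add,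
        Matrix.trace_smul, hσ.2, show Φ.trace = 1 from isState_bellOp_one.2,
        show fidelity Φ = 1 from fidelity_bellOp_one] at h1
      simp at h1
      linarith
    rw [Function.update_self, hF, MultilinearMap.map_update_add, MultilinearMap.map_update_add,
      MultilinearMap.map_update_smul, MultilinearMap.map_update_smul,
      MultilinearMap.map_update_smul, MultilinearMap.map_update_smul] at h
    simp only [smul_eq_mul] at h
    have h2 : 0 ≤ (1 - ε) * E.successLoss (Function.update ρ i Φ) :=
      mul_nonneg (by linarith [hε.2]) h0
    refine le_of_mul_le_mul_left ?_ hε.1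
    linarith
  have hlim : Tendsto (fun ε : ℝ => (1 - fidelity σ) *
      ((1 - ε) * E.successProb (Function.update ρ i Φ) +
        ε * E.successProb (Function.update ρ i σ))) (𝓝[>] 0)
      (𝓝 ((1 - fidelity σ) * E.successProb (Function.update ρ i Φ))) := by
    have : Continuous (fun ε : ℝ => (1 - fidelity σ) *
      ((1 - ε) * E.successProb (Function.update ρ i Φ) +
        ε * E.successProb (Function.update ρ i σ))) := by fun_prop
    simpa using (this.tendsto 0).mono_left nhdsWithin_le_nhds
  exact ge_of_tendsto hlim hev

end EPP

/-- The bilinear map obtained from `f` by fixing all inputs except the `i`-th and the `j`-th. -/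
noncomputable def bilinearSlots {n : ℕ} {i j : Fin n} (hij : i ≠ j)
    (f : MultilinearMap ℝ (fun _ : Fin n => Op (Qubit × Qubit)) ℝ)
    (ρ : Fin n → Op (Qubit × Qubit)) :
    Op (Qubit × Qubit) →ₗ[ℝ] Op (Qubit × Qubit) →ₗ[ℝ] ℝ :=
  LinearMap.mk₂ ℝ (fun σ τ => f (Function.update (Function.update ρ i σ) j τ))
    (fun σ σ' τ => by simp only [Function.update_comm hij, MultilinearMap.map_update_add])
    (fun c σ τ => by simp only [Function.update_comm hij, MultilinearMap.map_update_smul])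
    (fun σ τ τ' => by simp only [MultilinearMap.map_update_add])
    (fun c σ τ => by simp only [MultilinearMap.map_update_smul])

theorem forall_update_update {n : ℕ} {P : Op (Qubit × Qubit) → Prop}
    {ρ : Fin n → Op (Qubit × Qubit)} (hρ : ∀ k, P (ρ k)) {σ τ : Op (Qubit × Qubit)} (hσ : P σ)
    (hτ : P τ) (i j k : Fin n) : P (Function.update (Function.update ρ i σ) j τ k) := by
  simp only [Function.update_apply]
  split_ifs <;> simp [*]

theorem EPP.isUniversalPair {n : ℕ} {E : EPP n} (hL : E.IsLOCC)
    (hE : E.IsUniversalFor entangledStates) {i j : Fin n} (hij : i ≠ j)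
    {ρ : Fin n → Op (Qubit × Qubit)} (hρ : ∀ k, ρ k ∈ closure entangledStates)
    (hρ' : ∀ k, ρ k ∈ productStates) :
    IsUniversalPair (bilinearSlots hij E.successProb ρ) (bilinearSlots hij E.successLoss ρ) where
  nonneg σ τ hσ hτ := E.successLoss_nonneg
    (forall_update_update (fun k => (isState_of_mem_productStates (hρ' k)).1) hσ hτ i j)
  le σ τ hσ hτ := E.successLoss_le_successProb
    (forall_update_update (fun k => (isState_of_mem_productStates (hρ' k)).1) hσ hτ i j)
  le_of_product σ hσ τ hτ := hL.successProb_le (forall_update_update hρ' hσ hτ i j)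
  left σ hσ τ hτ := by
    simp only [bilinearSlots, LinearMap.mk₂_apply, Function.update_comm hij]
    refine successLoss_update_le hE (fun k hk => ?_) hσ
    rw [Function.update_apply]
    split_ifs
    exacts [hτ, hρ k]
  right σ hσ τ hτ := by
    simp only [bilinearSlots, LinearMap.mk₂_apply]
    refine successLoss_update_le hE (fun k hk => ?_) hτ
    rw [Function.update_apply]
    split_ifs
    exacts [hσ, hρ k]

end Purification

open Purification in
theorem theorem1 (n : ℕ) (hn : 2 ≤ n) :
    ¬ ∃ E : Purification.EPP n,
      E.IsLOCC ∧ E.branch true ≠ 0 ∧ E.IsUniversalFor Purification.entangledStates := by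
  rintro ⟨E, hL, hne, hE⟩
  refine hne (E.branch_eq_zero ?_)
  obtain ⟨i, j, hij⟩ : ∃ i j : Fin n, i ≠ j := ⟨⟨0, by omega⟩, ⟨1, by omega⟩, by simp⟩
  have hzero (x : Fin n → Qubit × Qubit) :
      (E.branch true (tensorPairs fun k => basisState (x k).1 ⊗ₖ basisState (x k).2)).trace = 0 := by
    have hmem k := basisState_kronecker_mem_productStates (x k).1 (x k).2
    have h := (EPP.isUniversalPair hL hE hij (fun k => basisState_kronecker_mem (x k).1 (x k).2)
      hmem).prob_basisState (x i).1 (x i).2 (x j).1 (x j).2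
    simp only [bilinearSlots, LinearMap.mk₂_apply, Function.update_eq_self] at h
    have hpos := E.posSemidef_branch
      (posSemidef_tensorPairs fun k => (isState_of_mem_productStates (hmem k)).1)
    rw [Complex.eq_re_of_ofReal_le hpos.trace_nonneg]
    exact congrArg Complex.ofReal h
  rw [← sum_tensorPairs_basisState, map_sum, Matrix.trace_sum]
  exact Finset.sum_eq_zero fun x _ => hzero x
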